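/- Let $\mathbb T=\mathbb R/2\pi\mathbb Z$, $\chi(\theta)=e^{i\theta}$, $\hat h(k)=\frac1{2\pi}\int_0^{2\pi}h(\theta)e^{-ik\theta}\,d\theta$, and let $A(\mathbb T,\tfrac32)$ be the set of all $h\in L^2(\mathbb T)$ with $\sum_{k\in\mathbb Z}|k|^{3/2}|\hat h(k)|<\infty$. For real $f\in L^1(\mathbb T)$ and $N\ge 0$ let $T_N(f)=\big(\hat f(l-k)\big)_{0\le k,l\le N}$. Let $0<\alpha_1<\tfrac12$ and $-\tfrac12<\alpha_2<0$, let $c_1,c_2$ be continuous, strictly positive functions on $\mathbb T$ belonging to $A(\mathbb T,\tfrac32)$, and assume that the functions $f_1=|1-\chi|^{2\alpha_1}c_1$ and $f_2=|1-\chi|^{2\alpha_2}c_2$ are even. Then, for every $N$, the matrix $T_N(f_2)$ is invertible and all eigenvalues of $T_N(f_1)T_N(f_2)^{-1}$ are real. Let $\mu_0^{(N)}\le\dots\le\mu_N^{(N)}$ be these eigenvalues in increasing order, repeated according to algebraic multiplicity. As $N\to\infty$, the probability measures $$\frac1{N+1}\sum_{i=0}^{N}\delta_{\mu_i^{(N)}}$$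 converge weakly to the image of the normalised Lebesgue measure $\frac{d\theta}{2\pi}$ on $\mathbb T$ under $f_1/f_2$. -/

import Mathlib

open scoped Topology

namespace ToeplitzSpectra

noncomputable section

/-- The torus `ℝ / 2πℤ`. -/
abbrev Torus : Type := AddCircle (2 * Real.pi)

instance fact_two_pi_pos : Fact (0 < 2 * Real.pi) := ⟨Real.two_pi_pos⟩

/-- Normalised Lebesgue measure `dθ / 2π` on the torus, as a probability measure. -/
def lebesgueTorus : MeasureTheory.ProbabilityMeasure Torus :=
  ⟨AddCircle.haarAddCircle, inferInstance⟩

/-- The function `χ(θ) = e^{iθ}` on the torus. -/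
def chi (θ : Torus) : ℂ := (AddCircle.toCircle θ : ℂ)

/-- The class `A(𝕋, ν)` of the functions `h ∈ L²(𝕋)` with `∑_k |k|^ν |ĥ(k)| < ∞`. -/
def MemA (ν : ℝ) (h : Torus → ℂ) : Prop :=
  MeasureTheory.MemLp h 2 AddCircle.haarAddCircle ∧
    Summable fun k : ℤ => |(k : ℝ)| ^ ν * ‖fourierCoeff h k‖

/-- The symbol `|1 - χ|^{2α} c`. -/
def symbol (α : ℝ) (c : C(Torus, ℝ)) (θ : Torus) : ℝ :=
  ‖1 - chi θ‖ ^ (2 * α) * c θ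

/-- The Toeplitz matrix `T_N(f)`, of size `(N + 1) × (N + 1)`, whose entry at `(k, l)`,
`0 ≤ k, l ≤ N`, is the Fourier coefficient `f̂(l - k)`. -/
def toeplitz (N : ℕ) (f : Torus → ℝ) : Matrix (Fin (N + 1)) (Fin (N + 1)) ℂ :=
  Matrix.of fun k l => fourierCoeff (fun θ => (f θ : ℂ)) ((l : ℤ) - (k : ℤ))

/-- `μ` lists, in increasing order and with algebraic multiplicity, the eigenvalues of the
complex matrix `A`; in particular all of them are real. -/
def IsOrderedSpectrum {n : ℕ} (A : Matrix (Fin n) (Fin n) ℂ) (μ : Fin n → ℝ) : Prop :=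
  Monotone μ ∧ A.charpoly = ∏ i, (Polynomial.X - Polynomial.C (μ i : ℂ))

/-- The normalised empirical measure `(N + 1)⁻¹ ∑_{i=0}^N δ_{μ i}`. -/
def empiricalMeasure {N : ℕ} (μ : Fin (N + 1) → ℝ) : MeasureTheory.ProbabilityMeasure ℝ :=
  ⟨((N : ENNReal) + 1)⁻¹ • ∑ i, MeasureTheory.Measure.dirac (μ i), ⟨by
    have h0 : ((N : ENNReal) + 1) ≠ 0 := by simp
    have h1 : ((N : ENNReal) + 1) ≠ ⊤ := by simp
    simp [ENNReal.inv_mul_cancel h0 h1]⟩⟩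

theorem measurable_symbol (α : ℝ) (c : C(Torus, ℝ)) : Measurable (symbol α c) := by
  have hchi : Continuous chi := continuous_subtype_val.comp AddCircle.continuous_toCircle
  exact (((continuous_const.sub hchi).norm.measurable).pow_const _).mul c.continuous.measurable

theorem measurable_symbol_div (α₁ α₂ : ℝ) (c₁ c₂ : C(Torus, ℝ)) :
    Measurable fun θ => symbol α₁ c₁ θ / symbol α₂ c₂ θ :=
  (measurable_symbol α₁ c₁).div (measurable_symbol α₂ c₂)

end

end ToeplitzSpectra

open ToeplitzSpectra

/-!
The empirical eigenvalue measures are identified by their logarithmic integrals. Write `f`, `g` for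
the two symbols. They are integrable, `g` is bounded below by some `δ > 0`, and `0 ≤ f ≤ M g` almost
everywhere, so `T_N(g)` is positive definite and, writing `T_N(g) = Cᴴ C`, the matrix
`T_N(f) T_N(g)⁻¹` has the characteristic polynomial of a Hermitian matrix
(`exists_isOrderedSpectrum`). Its eigenvalues `μ_i` lie in `[0, M]` (`mem_Icc_of_isOrderedSpectrum`),
and since `∏ (s + μ_i) = det T_N(f + s g) / det T_N(g)`, the mean of `log (s + μ_i)` converges for
every `s > 0` to `∫ log (f + s g) - ∫ log g = ∫ log (s + f / g)`, by Szegő's first limit theorem.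
Expanding the logarithm at large `s` gives the convergence of all moments, hence weak convergence on
the compact interval `[0, M]` (`tendsto_of_tendsto_integral_log`).

Szegő's theorem, `log det T_N(h) / (N + 1) → ∫ log h` for integrable `h ≥ δ > 0`, follows from two
applications of `log x ≤ log a + (x - a) / a`. Let `λ_i` be the eigenvalues of `T_N(h)`, with an
orthonormal basis of eigenvectors `b_i`, and let `w_i = |trigPoly b_i|²`. These functions satisfy
`∫ w_i = 1`, `∑ w_i = N + 1`, `∫ h w_i = λ_i` and `∑ λ_i w_i = (N + 1) σ_N h`, where `σ_N h` is the
Fejér mean.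
* With `x = h(θ)` and `a = λ_i`, integrated against `w_i`: `log λ_i ≥ ∫ w_i log h`, whose sum over
  `i` is `(N + 1) ∫ log h` (`mul_integral_log_le`).
* With `x = λ_i` and `a = h(θ)`, summed against `w_i(θ)` and integrated:
  `∑ log λ_i ≤ (N + 1) (∫ log h + δ⁻¹ ‖σ_N h - h‖₁)` (`log_norm_det_le`).

The error term tends to zero by Fejér's theorem in `L¹` (`tendsto_fejerError`).
-/

namespace ToeplitzSpectra

open MeasureTheory AddCircle Matrix Filter
open scoped ComplexConjugate ComplexOrder

/-! ### Toeplitz matrices as quadratic forms -/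

/-- The trigonometric polynomial `∑_l x_l χ^{-l}` attached to a vector of coefficients. The
negative exponents make `⟪x, T_N(h) x⟫ = ∫ h |trigPoly x|²` with the convention
`T_N(h)_{k,l} = ĥ(l - k)`. -/
noncomputable def trigPoly {N : ℕ} (x : Fin (N + 1) → ℂ) (θ : Torus) : ℂ :=
  ∑ l, x l * fourier (-(l : ℤ)) θ

theorem continuous_trigPoly {N : ℕ} (x : Fin (N + 1) → ℂ) : Continuous (trigPoly x) :=
  continuous_finsetSum _ fun l _ => continuous_const.mul (fourier (-(l : ℤ))).continuous

theorem integral_fourier (n : ℤ) :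
    ∫ θ : Torus, fourier n θ ∂haarAddCircle = if n = 0 then 1 else 0 := by
  split_ifs with h
  · simp [h]
  · exact integral_eq_zero_of_add_right_eq_neg (μ := haarAddCircle)
      (fourier_add_half_inv_index h Real.two_pi_pos)

theorem integrable_mul_normSq_trigPoly {N : ℕ} {h : Torus → ℝ} (hh : Integrable h haarAddCircle)
    (x : Fin (N + 1) → ℂ) : Integrable (fun θ => h θ * ‖trigPoly x θ‖ ^ 2) haarAddCircle := by
  have hc : Continuous fun θ => ‖trigPoly x θ‖ ^ 2 := (continuous_trigPoly x).norm.pow 2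
  obtain ⟨C, hC⟩ := isCompact_univ.exists_bound_of_continuousOn hc.continuousOn
  exact hh.mul_bdd hc.aestronglyMeasurable (ae_of_all _ fun θ => hC θ trivial)

theorem star_dotProduct_toeplitz_mulVec {N : ℕ} {h : Torus → ℝ}
    (hh : Integrable h haarAddCircle) (x : Fin (N + 1) → ℂ) :
    star x ⬝ᵥ (toeplitz N h *ᵥ x) =
      ((∫ θ, h θ * ‖trigPoly x θ‖ ^ 2 ∂haarAddCircle : ℝ) : ℂ) := by
  have hhc : Integrable (fun θ => (h θ : ℂ)) haarAddCircle := hh.ofReal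
  have key : ∀ θ : Torus, ((h θ * ‖trigPoly x θ‖ ^ 2 : ℝ) : ℂ) =
      ∑ k : Fin (N + 1), ∑ l : Fin (N + 1),
        (conj (x k) * x l) * (fourier (-((l : ℤ) - (k : ℤ))) θ • (h θ : ℂ)) := by
    intro θ
    have : ((‖trigPoly x θ‖ ^ 2 : ℝ) : ℂ) = conj (trigPoly x θ) * trigPoly x θ := by
      rw [mul_comm, Complex.mul_conj, Complex.normSq_eq_norm_sq]
    rw [Complex.ofReal_mul, this, trigPoly, map_sum, Finset.sum_mul_sum, Finset.mul_sum]
    refine Finset.sum_congr rfl fun k _ => ?_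
    rw [Finset.mul_sum]
    refine Finset.sum_congr rfl fun l _ => ?_
    rw [neg_sub, sub_eq_add_neg, fourier_add, map_mul, ← fourier_neg, neg_neg, smul_eq_mul]
    ring
  rw [← integral_complex_ofReal]
  simp_rw [key]
  have hint : ∀ k l : Fin (N + 1), Integrable (fun θ =>
      (conj (x k) * x l) * (fourier (-((l : ℤ) - (k : ℤ))) θ • (h θ : ℂ))) haarAddCircle :=
    fun k l => (hhc.fourier_smul _).const_mul _
  rw [integral_finsetSum _ fun k _ => integrable_finsetSum _ fun l _ => hint k l]
  simp only [dotProduct, mulVec, Pi.star_apply, Finset.mul_sum]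
  refine Finset.sum_congr rfl fun k _ => ?_
  rw [integral_finsetSum _ fun l _ => hint k l]
  refine Finset.sum_congr rfl fun l _ => ?_
  rw [integral_const_mul]
  simp only [toeplitz, of_apply, fourierCoeff, RCLike.star_def]
  ring

theorem toeplitz_one (N : ℕ) : toeplitz N (fun _ => 1) = 1 := by
  ext k l
  simp only [toeplitz, of_apply, fourierCoeff, Complex.ofReal_one, smul_eq_mul, mul_one,
    integral_fourier, one_apply]
  congr 1
  simp only [eq_iff_iff, Fin.ext_iff]
  omega

/-- Parseval's identity for trigonometric polynomials. -/
theorem integral_normSq_trigPoly {N : ℕ} (x : Fin (N + 1) → ℂ) :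
    ∫ θ, ‖trigPoly x θ‖ ^ 2 ∂haarAddCircle = ∑ l, ‖x l‖ ^ 2 := by
  have h := star_dotProduct_toeplitz_mulVec (integrable_const (1 : ℝ)) x
  rw [toeplitz_one, one_mulVec] at h
  simp only [one_mul] at h
  rw [← Complex.ofReal_inj, ← h, dotProduct, Complex.ofReal_sum]
  refine Finset.sum_congr rfl fun l _ => ?_
  rw [Pi.star_apply, RCLike.star_def, mul_comm, Complex.mul_conj, Complex.normSq_eq_norm_sq]

theorem isHermitian_toeplitz (N : ℕ) (h : Torus → ℝ) : (toeplitz N h).IsHermitian := by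
  ext k l
  simp only [toeplitz, conjTranspose_apply, of_apply, fourierCoeff, RCLike.star_def,
    ← integral_conj]
  congr 1 with θ
  rw [smul_eq_mul, smul_eq_mul, map_mul, Complex.conj_ofReal, ← fourier_neg]
  congr 3
  ring

/-- A symbol that is positive almost everywhere has positive definite Toeplitz matrices: if
`∫ h |trigPoly x|² = 0`, then `trigPoly x` vanishes almost everywhere, and `x = 0` by Parseval. -/
theorem posDef_toeplitz (N : ℕ) {h : Torus → ℝ} (hh : Integrable h haarAddCircle)
    (hpos : ∀ᵐ θ ∂haarAddCircle, 0 < h θ) : (toeplitz N h).PosDef := by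
  refine posDef_iff_dotProduct_mulVec.mpr ⟨isHermitian_toeplitz N h, fun x hx => ?_⟩
  rw [star_dotProduct_toeplitz_mulVec hh, Complex.zero_lt_real]
  have hnn : 0 ≤ᵐ[haarAddCircle] fun θ => h θ * ‖trigPoly x θ‖ ^ 2 := by
    filter_upwards [hpos] with θ hθ
    simp only [Pi.zero_apply]
    positivity
  refine (integral_nonneg_of_ae hnn).lt_of_ne fun h0 => hx ?_
  rw [eq_comm, integral_eq_zero_iff_of_nonneg_ae hnn (integrable_mul_normSq_trigPoly hh x)] at h0
  have h1 : ∫ θ, ‖trigPoly x θ‖ ^ 2 ∂haarAddCircle = 0 := by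
    refine integral_eq_zero_of_ae ?_
    filter_upwards [hpos, h0] with θ hθ h0θ
    exact (mul_eq_zero.mp h0θ).resolve_left hθ.ne'
  rw [integral_normSq_trigPoly, Finset.sum_eq_zero_iff_of_nonneg fun _ _ => by positivity] at h1
  ext l
  simpa using h1 l (Finset.mem_univ l)

theorem toeplitz_add (N : ℕ) {f g : Torus → ℝ} (hf : Integrable f haarAddCircle)
    (hg : Integrable g haarAddCircle) :
    toeplitz N (fun θ => f θ + g θ) = toeplitz N f + toeplitz N g := by
  ext k l
  have hfc : Integrable (fun θ => (f θ : ℂ)) haarAddCircle := hf.ofReal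
  have hgc : Integrable (fun θ => (g θ : ℂ)) haarAddCircle := hg.ofReal
  have := congrFun (fourierCoeff.add hfc hgc) ((l : ℤ) - (k : ℤ))
  simpa [toeplitz, Pi.add_def] using this

theorem toeplitz_const_mul (N : ℕ) (f : Torus → ℝ) (c : ℝ) :
    toeplitz N (fun θ => c * f θ) = (c : ℂ) • toeplitz N f := by
  ext k l
  simp [toeplitz, fourierCoeff.const_mul]

/-! ### Fejér means in `L¹` -/

/-- The vector `(1, χ(θ), …, χ(θ)^N)`. -/
noncomputable def charVec (N : ℕ) (θ : Torus) (l : Fin (N + 1)) : ℂ := fourier (l : ℤ) θ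

/-- The Fejér kernel `|∑_{l ≤ N} χ(θ - t)^l|² / (N + 1)`, as a function of two points. -/
noncomputable def fejerKernel (N : ℕ) (θ t : Torus) : ℝ :=
  ‖trigPoly (charVec N θ) t‖ ^ 2 / (N + 1)

/-- The Fejér mean of order `N` of a function on the torus. -/
noncomputable def fejerMean (N : ℕ) (q : Torus → ℂ) (θ : Torus) : ℂ :=
  ∫ t, (fejerKernel N θ t : ℂ) * q t ∂haarAddCircle

theorem norm_fourier_apply (n : ℤ) (θ : Torus) : ‖fourier n θ‖ = 1 := Circle.norm_coe _

theorem sum_normSq_charVec (N : ℕ) (θ : Torus) : ∑ l, ‖charVec N θ l‖ ^ 2 = (N : ℝ) + 1 := by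
  simp only [charVec, norm_fourier_apply]
  simp

theorem fejerKernel_nonneg (N : ℕ) (θ t : Torus) : 0 ≤ fejerKernel N θ t := by
  unfold fejerKernel
  positivity

theorem fejerKernel_comm (N : ℕ) (θ t : Torus) : fejerKernel N θ t = fejerKernel N t θ := by
  unfold fejerKernel
  rw [← RCLike.norm_conj]
  congr 3
  simp only [trigPoly, charVec, map_sum, map_mul, ← fourier_neg, neg_neg]
  exact Finset.sum_congr rfl fun l _ => mul_comm _ _

theorem continuous_fejerKernel (N : ℕ) :
    Continuous fun p : Torus × Torus => fejerKernel N p.1 p.2 := by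
  have hf : ∀ n : ℤ, Continuous (fun θ : Torus => fourier n θ) := fun n => (fourier n).continuous
  refine Continuous.div_const (Continuous.pow (Continuous.norm ?_) 2) _
  exact continuous_finsetSum _ fun l _ =>
    ((hf l).comp continuous_fst).mul ((hf (-(l : ℤ))).comp continuous_snd)

theorem integral_fejerKernel_right (N : ℕ) (θ : Torus) :
    ∫ t, fejerKernel N θ t ∂haarAddCircle = 1 := by
  simp only [fejerKernel]
  rw [integral_div, integral_normSq_trigPoly, sum_normSq_charVec, div_self (by positivity)]

theorem integral_fejerKernel_left (N : ℕ) (t : Torus) :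
    ∫ θ, fejerKernel N θ t ∂haarAddCircle = 1 := by
  simp_rw [fejerKernel_comm N _ t]
  exact integral_fejerKernel_right N t

theorem integrable_fejerKernel_mul_prod (N : ℕ) {q : Torus → ℂ}
    (hq : Integrable q haarAddCircle) :
    Integrable (fun p : Torus × Torus => (fejerKernel N p.1 p.2 : ℂ) * q p.2)
      (haarAddCircle.prod haarAddCircle) := by
  have hc : Continuous fun p : Torus × Torus => (fejerKernel N p.1 p.2 : ℂ) :=
    Complex.continuous_ofReal.comp (continuous_fejerKernel N)
  obtain ⟨C, hC⟩ := isCompact_univ.exists_bound_of_continuousOn hc.continuousOn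
  have hs : Integrable (fun p : Torus × Torus => q p.2)
      ((haarAddCircle : Measure Torus).prod haarAddCircle) := hq.comp_snd _
  exact hs.bdd_mul hc.aestronglyMeasurable (ae_of_all _ fun p => hC p trivial)

theorem integrable_fejerKernel_mul (N : ℕ) {q : Torus → ℂ} (hq : Integrable q haarAddCircle)
    (θ : Torus) : Integrable (fun t => (fejerKernel N θ t : ℂ) * q t) haarAddCircle := by
  have hc : Continuous fun t => (fejerKernel N θ t : ℂ) :=
    Complex.continuous_ofReal.comp (((continuous_trigPoly (charVec N θ)).norm.pow 2).div_const _)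
  obtain ⟨C, hC⟩ := isCompact_univ.exists_bound_of_continuousOn hc.continuousOn
  exact hq.bdd_mul hc.aestronglyMeasurable (ae_of_all _ fun p => hC p trivial)

theorem integrable_fejerMean (N : ℕ) {q : Torus → ℂ} (hq : Integrable q haarAddCircle) :
    Integrable (fejerMean N q) haarAddCircle :=
  (integrable_fejerKernel_mul_prod N hq).integral_prod_left

theorem fejerMean_add (N : ℕ) {q r : Torus → ℂ} (hq : Integrable q haarAddCircle)
    (hr : Integrable r haarAddCircle) (θ : Torus) :
    fejerMean N (fun t => q t + r t) θ = fejerMean N q θ + fejerMean N r θ := by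
  simp only [fejerMean, mul_add]
  exact integral_add (integrable_fejerKernel_mul N hq θ) (integrable_fejerKernel_mul N hr θ)

theorem fejerMean_const_mul (N : ℕ) (q : Torus → ℂ) (c : ℂ) (θ : Torus) :
    fejerMean N (fun t => c * q t) θ = c * fejerMean N q θ := by
  simp only [fejerMean, ← integral_const_mul]
  congr 1 with t
  ring

/-- Fejér means contract the `L¹` norm, the kernel being nonnegative of integral one. -/
theorem integral_norm_fejerMean_le (N : ℕ) {q : Torus → ℂ} (hq : Integrable q haarAddCircle) :
    ∫ θ, ‖fejerMean N q θ‖ ∂haarAddCircle ≤ ∫ θ, ‖q θ‖ ∂haarAddCircle := by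
  have hp := (integrable_fejerKernel_mul_prod N hq).norm
  calc ∫ θ, ‖fejerMean N q θ‖ ∂haarAddCircle
      ≤ ∫ θ, ∫ t, ‖(fejerKernel N θ t : ℂ) * q t‖ ∂haarAddCircle ∂haarAddCircle :=
        integral_mono (integrable_fejerMean N hq).norm hp.integral_prod_left
          fun θ => norm_integral_le_integral_norm _
    _ = ∫ t, ∫ θ, ‖(fejerKernel N θ t : ℂ) * q t‖ ∂haarAddCircle ∂haarAddCircle :=
        integral_integral_swap hp
    _ = ∫ t, ‖q t‖ ∂haarAddCircle := by
        congr 1 with t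
        simp_rw [norm_mul, Complex.norm_real, Real.norm_of_nonneg (fejerKernel_nonneg N _ t)]
        rw [integral_mul_const, integral_fejerKernel_left, one_mul]

/-- The `L¹` distance from a function to its Fejér mean. -/
noncomputable def fejerError (N : ℕ) (q : Torus → ℂ) : ℝ :=
  ∫ θ, ‖fejerMean N q θ - q θ‖ ∂haarAddCircle

theorem fejerError_nonneg (N : ℕ) (q : Torus → ℂ) : 0 ≤ fejerError N q :=
  integral_nonneg fun _ => norm_nonneg _

theorem integrable_fejerMean_sub (N : ℕ) {q : Torus → ℂ} (hq : Integrable q haarAddCircle) :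
    Integrable (fun θ => fejerMean N q θ - q θ) haarAddCircle :=
  (integrable_fejerMean N hq).sub hq

theorem fejerError_add_le (N : ℕ) {q r : Torus → ℂ} (hq : Integrable q haarAddCircle)
    (hr : Integrable r haarAddCircle) :
    fejerError N (fun t => q t + r t) ≤ fejerError N q + fejerError N r := by
  have h1 := (integrable_fejerMean_sub N hq).norm
  have h2 := (integrable_fejerMean_sub N hr).norm
  unfold fejerError
  rw [← integral_add h1 h2]
  refine integral_mono (integrable_fejerMean_sub N (hq.add hr)).norm (h1.add h2) fun θ => ?_
  simp only [fejerMean_add N hq hr θ]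
  rw [add_sub_add_comm]
  exact norm_add_le _ _

theorem fejerError_const_mul (N : ℕ) (q : Torus → ℂ) (c : ℂ) :
    fejerError N (fun t => c * q t) = ‖c‖ * fejerError N q := by
  simp only [fejerError, fejerMean_const_mul, ← mul_sub, norm_mul, integral_const_mul]

theorem fejerError_le_two_mul (N : ℕ) {q : Torus → ℂ} (hq : Integrable q haarAddCircle) :
    fejerError N q ≤ 2 * ∫ θ, ‖q θ‖ ∂haarAddCircle := by
  have h1 := (integrable_fejerMean N hq).norm
  calc fejerError N q ≤ ∫ θ, (‖fejerMean N q θ‖ + ‖q θ‖) ∂haarAddCircle :=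
        integral_mono (integrable_fejerMean_sub N hq).norm (h1.add hq.norm)
          fun θ => norm_sub_le _ _
    _ ≤ _ := by
        have := integral_norm_fejerMean_le N hq
        rw [integral_add h1 hq.norm]
        linarith

/-- The Fejér mean multiplies `χ^n` by the proportion of the `l ≤ N` with `0 ≤ l + n ≤ N`. -/
theorem fejerMean_fourier (N : ℕ) (n : ℤ) (θ : Torus) :
    fejerMean N (fourier n) θ =
      ((Finset.univ.filter fun l : Fin (N + 1) =>
        0 ≤ (l : ℤ) + n ∧ (l : ℤ) + n ≤ N).card : ℂ) / (N + 1) * fourier n θ := by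
  have key : ∀ t : Torus, (fejerKernel N θ t : ℂ) * fourier n t =
      ∑ l : Fin (N + 1), ∑ k : Fin (N + 1),
        (fourier ((k : ℤ) - l) θ / (N + 1)) * fourier ((l : ℤ) + n - k) t := by
    intro t
    have : ((‖trigPoly (charVec N θ) t‖ ^ 2 : ℝ) : ℂ) =
        conj (trigPoly (charVec N θ) t) * trigPoly (charVec N θ) t := by
      rw [mul_comm, Complex.mul_conj, Complex.normSq_eq_norm_sq]
    rw [fejerKernel, Complex.ofReal_div, this, trigPoly, map_sum, Finset.sum_mul_sum,
      Finset.sum_div, Finset.sum_mul]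
    refine Finset.sum_congr rfl fun l _ => ?_
    rw [Finset.sum_div, Finset.sum_mul]
    refine Finset.sum_congr rfl fun k _ => ?_
    simp only [charVec, map_mul, ← fourier_neg, neg_neg, sub_eq_add_neg, fourier_add]
    push_cast
    ring
  have hcont : ∀ m : ℤ, Integrable (fun t : Torus => fourier m t) haarAddCircle := fun m =>
    (fourier m).continuous.integrable_of_hasCompactSupport (HasCompactSupport.of_compactSpace _)
  unfold fejerMean
  simp_rw [key]
  rw [integral_finsetSum _ fun l _ => integrable_finsetSum _ fun k _ => (hcont _).const_mul _,
    Finset.card_filter]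
  push_cast
  rw [Finset.sum_div, Finset.sum_mul]
  refine Finset.sum_congr rfl fun l _ => ?_
  rw [integral_finsetSum _ fun k _ => (hcont _).const_mul _]
  simp_rw [integral_const_mul, integral_fourier]
  split_ifs with h
  · have hk : (l + n).toNat < N + 1 := by omega
    rw [Finset.sum_eq_single ⟨(l + n).toNat, hk⟩]
    · have h0 : ((l : ℤ) + n).toNat = (l : ℤ) + n := Int.toNat_of_nonneg h.1
      simp only [h0, sub_self, if_true, mul_one, add_sub_cancel_left]
      ring
    · intro k _ hkl
      rw [if_neg, mul_zero]
      intro h0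
      apply hkl
      ext
      simp only
      omega
    · simp
  · rw [Finset.sum_eq_zero]
    · simp
    intro k _
    rw [if_neg, mul_zero]
    have := k.2
    omega

theorem norm_fejerMean_fourier_sub_le (N : ℕ) (n : ℤ) (θ : Torus) :
    ‖fejerMean N (fourier n) θ - fourier n θ‖ ≤ |(n : ℝ)| / (N + 1) := by
  set S := Finset.univ.filter fun l : Fin (N + 1) => 0 ≤ (l : ℤ) + n ∧ (l : ℤ) + n ≤ N with hS
  have hle : S.card ≤ N + 1 := by simpa using Finset.card_le_univ S
  -- The `l` for which `l + n` leaves `[0, N]` are within `|n|` of one end of the range.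
  have hcompl : Sᶜ.card ≤ n.natAbs := by
    have : Sᶜ.card ≤
        (Finset.Ico 0 (-n) ∪ Finset.Ico ((N : ℤ) + 1 - n) (N + 1)).card := by
      refine Finset.card_le_card_of_injOn (fun l : Fin (N + 1) => (l : ℤ)) (fun l hl => ?_)
        fun a _ b _ hab => by simpa [Fin.ext_iff] using hab
      have h2 := l.2
      simp only [hS, Finset.coe_compl, Finset.coe_filter, Finset.mem_univ, true_and,
        Set.mem_compl_iff, Set.mem_ofPred_eq] at hl
      simp only [Finset.coe_union, Finset.coe_Ico, Set.mem_union, Set.mem_Ico]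
      omega
    refine (this.trans (Finset.card_union_le _ _)).trans ?_
    simp only [Int.card_Ico]
    omega
  have hge : (N : ℝ) + 1 ≤ S.card + |(n : ℝ)| := by
    have h1 := Finset.card_add_card_compl S
    rw [Fintype.card_fin] at h1
    have h2 : N + 1 ≤ S.card + n.natAbs := by omega
    have h3 : ((n.natAbs : ℕ) : ℝ) = |(n : ℝ)| := by simp [Nat.cast_natAbs]
    rw [← h3]
    exact_mod_cast h2
  have hpos : (0 : ℝ) < N + 1 := by positivity
  have : fejerMean N (fourier n) θ - fourier n θ =
      (((S.card : ℝ) / (N + 1) - 1 : ℝ) : ℂ) * fourier n θ := by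
    rw [fejerMean_fourier]
    push_cast
    ring
  rw [this, norm_mul, norm_fourier_apply, mul_one, Complex.norm_real, Real.norm_eq_abs,
    div_sub_one hpos.ne', abs_div, abs_of_pos hpos]
  refine div_le_div_of_nonneg_right ?_ hpos.le
  have hle' : (S.card : ℝ) ≤ N + 1 := by exact_mod_cast hle
  rw [abs_le]
  constructor <;> linarith [abs_nonneg (n : ℝ)]

theorem tendsto_fejerError_fourier (n : ℤ) :
    Tendsto (fun N => fejerError N (fourier n)) atTop (𝓝 0) := by
  have hlim : Tendsto (fun N : ℕ => |(n : ℝ)| / ((N : ℝ) + 1)) atTop (𝓝 0) :=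
    tendsto_const_nhds.div_atTop (tendsto_natCast_atTop_atTop.atTop_add tendsto_const_nhds)
  refine squeeze_zero (fun N => fejerError_nonneg N _) (fun N => ?_) hlim
  have := norm_integral_le_of_norm_le_const (μ := (haarAddCircle : Measure Torus))
    (f := fun θ => ‖fejerMean N (fourier n) θ - fourier n θ‖)
    (ae_of_all _ fun θ => by simpa using norm_fejerMean_fourier_sub_le N n θ)
  rw [probReal_univ, mul_one] at this
  exact (le_abs_self _).trans this

/-- Functions whose Fejér means converge in `L¹` form a closed set. -/
theorem tendsto_fejerError_of_approx {q : Torus → ℂ} (hq : Integrable q haarAddCircle)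
    (happ : ∀ ε > 0, ∃ r : Torus → ℂ, Integrable r haarAddCircle ∧
      ∫ θ, ‖q θ - r θ‖ ∂haarAddCircle ≤ ε ∧
      Tendsto (fun N => fejerError N r) atTop (𝓝 0)) :
    Tendsto (fun N => fejerError N q) atTop (𝓝 0) := by
  rw [Metric.tendsto_atTop]
  intro ε hε
  obtain ⟨r, hr, hqr, hlim⟩ := happ (ε / 4) (by positivity)
  obtain ⟨N₀, hN₀⟩ := (Metric.tendsto_atTop.mp hlim) (ε / 4) (by positivity)
  refine ⟨N₀, fun N hN => ?_⟩
  have h1 := hN₀ N hN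
  rw [Real.dist_0_eq_abs, abs_of_nonneg (fejerError_nonneg N _)] at h1 ⊢
  have h2 := fejerError_add_le N hr (hq.sub hr)
  have h3 := fejerError_le_two_mul N (hq.sub hr)
  simp only [Pi.sub_apply, add_sub_cancel] at h2 h3
  linarith

theorem integrable_continuousMap (g : C(Torus, ℂ)) : Integrable g haarAddCircle :=
  g.continuous.integrable_of_hasCompactSupport (HasCompactSupport.of_compactSpace _)

theorem tendsto_fejerError_continuous (g : C(Torus, ℂ)) :
    Tendsto (fun N => fejerError N g) atTop (𝓝 0) := by
  have hspan : ∀ p ∈ Submodule.span ℂ (Set.range (fourier (T := 2 * Real.pi))),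
      Tendsto (fun N => fejerError N p) atTop (𝓝 0) := by
    intro p hp
    induction hp using Submodule.span_induction with
    | mem p hp =>
      obtain ⟨n, rfl⟩ := hp
      exact tendsto_fejerError_fourier n
    | zero =>
      have : ∀ N, fejerError N (⇑(0 : C(Torus, ℂ))) = 0 := fun N => by
        simp [fejerError, fejerMean]
      simp only [this, tendsto_const_nhds]
    | add p r _ _ hp hr =>
      refine squeeze_zero (fun N => fejerError_nonneg N _) (fun N => ?_)
        (by simpa using hp.add hr)
      exact fejerError_add_le N (integrable_continuousMap p) (integrable_continuousMap r)
    | smul c p _ hp =>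
      have : ∀ N, fejerError N (⇑(c • p)) = ‖c‖ * fejerError N p :=
        fun N => fejerError_const_mul N p c
      simp only [this]
      simpa only [mul_zero] using hp.const_mul ‖c‖
  have hg : g ∈ closure (Submodule.span ℂ (Set.range (fourier (T := 2 * Real.pi))) :
      Set C(Torus, ℂ)) := by
    have := span_fourier_closure_eq_top (T := 2 * Real.pi)
    rw [← Submodule.topologicalClosure_coe, this]
    trivial
  refine tendsto_fejerError_of_approx (integrable_continuousMap g) fun ε hε => ?_
  obtain ⟨p, hp, hgp⟩ := Metric.mem_closure_iff.mp hg ε hε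
  refine ⟨p, integrable_continuousMap p, ?_, hspan p hp⟩
  have := norm_integral_le_of_norm_le_const (μ := (haarAddCircle : Measure Torus))
    (f := fun θ => ‖g θ - p θ‖) (C := ε)
    (ae_of_all _ fun θ => by
      rw [norm_norm, ← dist_eq_norm]
      exact (ContinuousMap.dist_apply_le_dist θ).trans hgp.le)
  rw [probReal_univ, mul_one] at this
  exact (le_abs_self _).trans this

/-- **Fejér's theorem in `L¹`**. -/
theorem tendsto_fejerError {q : Torus → ℂ} (hq : Integrable q haarAddCircle) :
    Tendsto (fun N => fejerError N q) atTop (𝓝 0) := by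
  refine tendsto_fejerError_of_approx hq fun ε hε => ?_
  obtain ⟨g, hg, hgi⟩ := hq.exists_boundedContinuous_integral_sub_le hε
  exact ⟨g, hgi, hg, tendsto_fejerError_continuous g.toContinuousMap⟩

/-! ### Szegő's limit theorem for symbols bounded away from zero -/

theorem log_le_log_add_div {a x : ℝ} (ha : 0 < a) (hx : 0 < x) :
    Real.log x ≤ Real.log a + (x - a) / a := by
  have h := Real.log_le_sub_one_of_pos (div_pos hx ha)
  rw [Real.log_div hx.ne' ha.ne'] at h
  rw [sub_div, div_self ha.ne']
  linarith

theorem integrable_log {h : Torus → ℝ} (hh : Integrable h haarAddCircle) {δ : ℝ} (hδ : 0 < δ)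
    (hle : ∀ᵐ θ ∂haarAddCircle, δ ≤ h θ) :
    Integrable (fun θ => Real.log (h θ)) haarAddCircle := by
  refine (hh.norm.add (integrable_const |Real.log δ|)).mono
    (Real.measurable_log.comp_aemeasurable hh.aemeasurable).aestronglyMeasurable ?_
  filter_upwards [hle] with θ hθ
  have hpos : 0 < h θ := hδ.trans_le hθ
  have h1 : Real.log δ ≤ Real.log (h θ) := Real.log_le_log hδ hθ
  have h2 := Real.log_le_sub_one_of_pos hpos
  have h3 := neg_abs_le (Real.log δ)
  simp only [Pi.add_apply, Real.norm_eq_abs]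
  rw [abs_of_pos hpos, abs_of_nonneg (by positivity : 0 ≤ h θ + |Real.log δ|), abs_le]
  have h4 := abs_nonneg (Real.log δ)
  constructor <;> linarith

section Eigenbasis

variable (N : ℕ) (h : Torus → ℝ)

/-- The eigenvalues of the Hermitian matrix `T_N(h)`. -/
noncomputable def toeplitzEigenvalue (i : Fin (N + 1)) : ℝ :=
  (isHermitian_toeplitz N h).eigenvalues i

/-- An orthonormal basis of eigenvectors of `T_N(h)`. -/
noncomputable def toeplitzEigenbasis :
    OrthonormalBasis (Fin (N + 1)) ℂ (EuclideanSpace ℂ (Fin (N + 1))) :=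
  (isHermitian_toeplitz N h).eigenvectorBasis

/-- The density `|trigPoly b_i|²` of the probability measure on the torus attached to the `i`-th
normalised eigenvector `b_i` of `T_N(h)`. -/
noncomputable def eigenDensity (i : Fin (N + 1)) (θ : Torus) : ℝ :=
  ‖trigPoly (toeplitzEigenbasis N h i) θ‖ ^ 2

theorem eigenDensity_nonneg (i : Fin (N + 1)) (θ : Torus) : 0 ≤ eigenDensity N h i θ := by
  unfold eigenDensity
  positivity

theorem trigPoly_eq_inner {N : ℕ} (x : EuclideanSpace ℂ (Fin (N + 1))) (θ : Torus) :
    trigPoly x θ = inner ℂ (WithLp.toLp 2 (charVec N θ)) x := by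
  simp only [trigPoly, PiLp.inner_apply, RCLike.inner_apply, charVec, fourier_neg]

theorem integrable_eigenDensity (i : Fin (N + 1)) :
    Integrable (eigenDensity N h i) haarAddCircle := by
  have := integrable_mul_normSq_trigPoly (integrable_const (1 : ℝ)) (toeplitzEigenbasis N h i)
  simp only [one_mul] at this
  exact this

theorem integral_eigenDensity (i : Fin (N + 1)) :
    ∫ θ, eigenDensity N h i θ ∂haarAddCircle = 1 := by
  unfold eigenDensity
  rw [integral_normSq_trigPoly, ← EuclideanSpace.norm_sq_eq,
    (toeplitzEigenbasis N h).norm_eq_one, one_pow]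

theorem sum_eigenDensity (θ : Torus) : ∑ i, eigenDensity N h i θ = N + 1 := by
  simp only [eigenDensity, trigPoly_eq_inner]
  rw [OrthonormalBasis.sum_sq_norm_inner_left, EuclideanSpace.norm_sq_eq]
  exact sum_normSq_charVec N θ

theorem toeplitz_mulVec_eigenbasis (i : Fin (N + 1)) :
    toeplitz N h *ᵥ toeplitzEigenbasis N h i =
      (toeplitzEigenvalue N h i : ℂ) • ⇑(toeplitzEigenbasis N h i) := by
  have := (isHermitian_toeplitz N h).mulVec_eigenvectorBasis i
  rw [RCLike.real_smul_eq_coe_smul (K := ℂ)] at this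
  exact this

variable {h} (hh : Integrable h haarAddCircle)

include hh

theorem integrable_mul_eigenDensity (i : Fin (N + 1)) :
    Integrable (fun θ => h θ * eigenDensity N h i θ) haarAddCircle :=
  integrable_mul_normSq_trigPoly hh _

/-- Each eigenvalue of `T_N(h)` is the mean of `h` for the corresponding density. -/
theorem integral_mul_eigenDensity (i : Fin (N + 1)) :
    ∫ θ, h θ * eigenDensity N h i θ ∂haarAddCircle = toeplitzEigenvalue N h i := by
  have h1 := star_dotProduct_toeplitz_mulVec hh (toeplitzEigenbasis N h i)
  have h2 : star ⇑(toeplitzEigenbasis N h i) ⬝ᵥ ⇑(toeplitzEigenbasis N h i) = 1 := by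
    rw [dotProduct_comm, ← EuclideanSpace.inner_eq_star_dotProduct,
      inner_self_eq_norm_sq_to_K, (toeplitzEigenbasis N h).norm_eq_one]
    simp
  rw [toeplitz_mulVec_eigenbasis, dotProduct_smul, h2, smul_eq_mul, mul_one] at h1
  exact_mod_cast h1.symm

/-- The weighted mean of the eigenvalues of `T_N(h)` at `θ` is the Fejér mean of `h`. -/
theorem sum_eigenvalue_mul_eigenDensity (θ : Torus) :
    ((∑ i, toeplitzEigenvalue N h i * eigenDensity N h i θ : ℝ) : ℂ) =
      (N + 1) * fejerMean N (fun t => (h t : ℂ)) θ := by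
  have hN : (N : ℂ) + 1 ≠ 0 := by exact_mod_cast N.succ_ne_zero
  have h1 : (N + 1) * fejerMean N (fun t => (h t : ℂ)) θ =
      star (charVec N θ) ⬝ᵥ (toeplitz N h *ᵥ charVec N θ) := by
    rw [star_dotProduct_toeplitz_mulVec hh, ← integral_complex_ofReal, fejerMean,
      ← integral_const_mul]
    congr 1 with t
    simp only [fejerKernel]
    push_cast
    field_simp
  rw [h1, dotProduct_comm]
  set b := toeplitzEigenbasis N h with hb
  set v : EuclideanSpace ℂ (Fin (N + 1)) := WithLp.toLp 2 (charVec N θ) with hv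
  have h2 : (toeplitz N h *ᵥ charVec N θ) ⬝ᵥ star (charVec N θ) =
      inner ℂ v (WithLp.toLp 2 (toeplitz N h *ᵥ charVec N θ)) := by
    rw [EuclideanSpace.inner_eq_star_dotProduct]
  rw [h2, ← b.sum_inner_mul_inner, Complex.ofReal_sum]
  refine Finset.sum_congr rfl fun i _ => ?_
  have h3 : inner ℂ (b i) (WithLp.toLp 2 (toeplitz N h *ᵥ charVec N θ)) =
      (toeplitzEigenvalue N h i : ℂ) * inner ℂ (b i) v := by
    rw [EuclideanSpace.inner_eq_star_dotProduct, EuclideanSpace.inner_eq_star_dotProduct]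
    change (toeplitz N h *ᵥ charVec N θ) ⬝ᵥ star ⇑(b i) =
      (toeplitzEigenvalue N h i : ℂ) * (charVec N θ ⬝ᵥ star ⇑(b i))
    rw [dotProduct_comm, dotProduct_mulVec, ← (isHermitian_toeplitz N h).eq, ← star_mulVec,
      hb, toeplitz_mulVec_eigenbasis, star_smul, smul_dotProduct, smul_eq_mul,
      RCLike.star_def, Complex.conj_ofReal, dotProduct_comm]
  rw [h3, Complex.ofReal_mul, eigenDensity, ← hb, trigPoly_eq_inner, ← hv,
    ← inner_conj_symm (b i) v, Complex.ofReal_pow, ← Complex.mul_conj']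
  ring

variable {δ : ℝ} (hδ : 0 < δ) (hle : ∀ᵐ θ ∂haarAddCircle, δ ≤ h θ)

include hδ hle

theorem toeplitzEigenvalue_pos (i : Fin (N + 1)) : 0 < toeplitzEigenvalue N h i :=
  (posDef_toeplitz N hh (hle.mono fun _ hθ => hδ.trans_le hθ)).eigenvalues_pos i

theorem log_norm_det_toeplitz :
    Real.log ‖(toeplitz N h).det‖ = ∑ i, Real.log (toeplitzEigenvalue N h i) := by
  rw [(isHermitian_toeplitz N h).det_eq_prod_eigenvalues, norm_prod,
    Real.log_prod fun i _ => ?_]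
  · refine Finset.sum_congr rfl fun i _ => ?_
    have := toeplitzEigenvalue_pos N hh hδ hle i
    rw [toeplitzEigenvalue] at this ⊢
    rw [RCLike.norm_ofReal, abs_of_pos this]
  · have := (toeplitzEigenvalue_pos N hh hδ hle i).ne'
    rw [toeplitzEigenvalue] at this
    simpa using this

/-- Lower bound in Szegő's theorem: Jensen's inequality for the mean of `h` representing each
eigenvalue. -/
theorem mul_integral_log_le :
    (N + 1) * ∫ θ, Real.log (h θ) ∂haarAddCircle ≤ Real.log ‖(toeplitz N h).det‖ := by
  have hlog := integrable_log hh hδ hle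
  have hi : ∀ i, Integrable (fun θ => Real.log (h θ) * eigenDensity N h i θ) haarAddCircle :=
    fun i => integrable_mul_normSq_trigPoly hlog _
  rw [log_norm_det_toeplitz N hh hδ hle]
  calc (N + 1) * ∫ θ, Real.log (h θ) ∂haarAddCircle
      = ∑ i, ∫ θ, Real.log (h θ) * eigenDensity N h i θ ∂haarAddCircle := by
        rw [← integral_finsetSum _ fun i _ => hi i, ← integral_const_mul]
        congr 1 with θ
        rw [← Finset.mul_sum, sum_eigenDensity, mul_comm]
    _ ≤ ∑ i, Real.log (toeplitzEigenvalue N h i) := by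
        -- The tangent of the logarithm at `λ_i` has integral `log λ_i` against `w_i`.
        refine Finset.sum_le_sum fun i _ => ?_
        set a := toeplitzEigenvalue N h i with ha
        have hapos : 0 < a := toeplitzEigenvalue_pos N hh hδ hle i
        have hw := integrable_eigenDensity N h i
        have hhw := integrable_mul_eigenDensity N hh i
        calc ∫ θ, Real.log (h θ) * eigenDensity N h i θ ∂haarAddCircle
            ≤ ∫ θ, ((Real.log a - 1) * eigenDensity N h i θ +
                a⁻¹ * (h θ * eigenDensity N h i θ)) ∂haarAddCircle := by
              refine integral_mono_ae (hi i) ((hw.const_mul _).add (hhw.const_mul _)) ?_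
              filter_upwards [hle] with θ hθ
              have h1 := mul_le_mul_of_nonneg_right
                (log_le_log_add_div hapos (hδ.trans_le hθ)) (eigenDensity_nonneg N h i θ)
              refine h1.trans_eq ?_
              field_simp
              ring
          _ = Real.log a := by
              rw [integral_add (hw.const_mul _) (hhw.const_mul _), integral_const_mul,
                integral_const_mul, integral_eigenDensity, integral_mul_eigenDensity N hh, ← ha,
                inv_mul_cancel₀ hapos.ne']
              ring

/-- Upper bound in Szegő's theorem: concavity of the logarithm at `h(θ)`, for the weights of the
eigenvalues at the point `θ`, whose weighted mean is the Fejér mean of `h`. -/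
theorem log_norm_det_le :
    Real.log ‖(toeplitz N h).det‖ ≤ (N + 1) * (∫ θ, Real.log (h θ) ∂haarAddCircle +
      δ⁻¹ * fejerError N fun θ => (h θ : ℂ)) := by
  have hlog := integrable_log hh hδ hle
  have hhc : Integrable (fun θ => (h θ : ℂ)) haarAddCircle := hh.ofReal
  have herr := (integrable_fejerMean_sub N hhc).norm
  have hw := integrable_eigenDensity N h
  rw [log_norm_det_toeplitz N hh hδ hle]
  calc ∑ i, Real.log (toeplitzEigenvalue N h i)
      = ∫ θ, ∑ i, Real.log (toeplitzEigenvalue N h i) * eigenDensity N h i θ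
          ∂haarAddCircle := by
        rw [integral_finsetSum _ fun i _ => (hw i).const_mul _]
        refine Finset.sum_congr rfl fun i _ => ?_
        rw [integral_const_mul, integral_eigenDensity, mul_one]
    _ ≤ ∫ θ, ((N : ℝ) + 1) * (Real.log (h θ) +
          δ⁻¹ * ‖fejerMean N (fun t => (h t : ℂ)) θ - h θ‖) ∂haarAddCircle := by
        refine integral_mono_ae (integrable_finsetSum _ fun i _ => (hw i).const_mul _)
          ((hlog.add (herr.const_mul _)).const_mul _) ?_
        filter_upwards [hle] with θ hθ
        have hpos : 0 < h θ := hδ.trans_le hθ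
        -- The tangent is taken at `h θ`, so that only `σ_N h - h` remains after the summation.
        set s := fejerMean N (fun t => (h t : ℂ)) θ with hs
        have hsum : ∑ i, toeplitzEigenvalue N h i * eigenDensity N h i θ = (N + 1) * s.re := by
          have := congrArg Complex.re (sum_eigenvalue_mul_eigenDensity N hh θ)
          rw [Complex.ofReal_re, ← hs] at this
          rw [this]
          simp
        calc ∑ i, Real.log (toeplitzEigenvalue N h i) * eigenDensity N h i θ
            ≤ ∑ i, ((Real.log (h θ) - 1) * eigenDensity N h i θ +
                (h θ)⁻¹ * (toeplitzEigenvalue N h i * eigenDensity N h i θ)) := by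
              refine Finset.sum_le_sum fun i _ => ?_
              have h1 := mul_le_mul_of_nonneg_right
                (log_le_log_add_div hpos (toeplitzEigenvalue_pos N hh hδ hle i))
                (eigenDensity_nonneg N h i θ)
              refine h1.trans_eq ?_
              field_simp
              ring
          _ = ((N : ℝ) + 1) * (Real.log (h θ) + (h θ)⁻¹ * (s.re - h θ)) := by
              rw [Finset.sum_add_distrib, ← Finset.mul_sum, ← Finset.mul_sum, sum_eigenDensity,
                hsum]
              field_simp
              ring
          _ ≤ _ := by
              have h2 : s.re - h θ ≤ ‖s - h θ‖ := by
                simpa using Complex.re_le_norm (s - h θ)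
              have h3 : (h θ)⁻¹ * (s.re - h θ) ≤ δ⁻¹ * ‖s - h θ‖ :=
                (mul_le_mul_of_nonneg_left h2 (inv_nonneg.mpr hpos.le)).trans
                  (mul_le_mul_of_nonneg_right (inv_anti₀ hδ hθ) (norm_nonneg _))
              exact mul_le_mul_of_nonneg_left (add_le_add_right h3 _) (by positivity)
    _ = _ := by
        rw [integral_const_mul, integral_add hlog (herr.const_mul _), integral_const_mul]
        rfl

end Eigenbasis

/-- **Szegő's first limit theorem** for an integrable symbol bounded below by a positive
constant. -/
theorem tendsto_log_norm_det_toeplitz {h : Torus → ℝ} (hh : Integrable h haarAddCircle) {δ : ℝ}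
    (hδ : 0 < δ) (hle : ∀ᵐ θ ∂haarAddCircle, δ ≤ h θ) :
    Tendsto (fun N : ℕ => ((N : ℝ) + 1)⁻¹ * Real.log ‖(toeplitz N h).det‖) atTop
      (𝓝 (∫ θ, Real.log (h θ) ∂haarAddCircle)) := by
  have hhc : Integrable (fun θ => (h θ : ℂ)) haarAddCircle := hh.ofReal
  have hup : Tendsto (fun N : ℕ => ∫ θ, Real.log (h θ) ∂haarAddCircle +
      δ⁻¹ * fejerError N fun θ => (h θ : ℂ)) atTop
      (𝓝 (∫ θ, Real.log (h θ) ∂haarAddCircle)) := by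
    simpa only [mul_zero, add_zero] using
      ((tendsto_fejerError hhc).const_mul δ⁻¹).const_add (∫ θ, Real.log (h θ) ∂haarAddCircle)
  refine tendsto_of_tendsto_of_tendsto_of_le_of_le tendsto_const_nhds hup (fun N => ?_)
    fun N => ?_
  · have hN : (0 : ℝ) < N + 1 := by positivity
    simp only
    rw [inv_mul_eq_div, le_div_iff₀' hN]
    exact mul_integral_log_le N hh hδ hle
  · have hN : (0 : ℝ) < N + 1 := by positivity
    simp only
    rw [inv_mul_eq_div, div_le_iff₀' hN]
    exact log_norm_det_le N hh hδ hle

/-! ### Weak convergence from convergence of logarithmic integrals -/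

theorem integrable_of_continuousOn_of_ae_mem {M : ℝ} {ν : Measure ℝ} [IsFiniteMeasure ν]
    (hν : ∀ᵐ x ∂ν, x ∈ Set.Icc 0 M) {φ : ℝ → ℝ} (hφ : ContinuousOn φ (Set.Icc 0 M)) :
    Integrable φ ν := by
  have := hφ.integrableOn_compact (μ := ν) isCompact_Icc
  rwa [IntegrableOn, Measure.restrict_eq_self_of_ae_mem hν] at this

section WeakLimit

variable {M : ℝ} {ν : ℕ → ProbabilityMeasure ℝ} {κ : ProbabilityMeasure ℝ}
  (hν : ∀ N, ∀ᵐ x ∂(ν N : Measure ℝ), x ∈ Set.Icc 0 M)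
  (hκ : ∀ᵐ x ∂(κ : Measure ℝ), x ∈ Set.Icc 0 M)

/-- The function `φ` is continuous on `[0, M]` and its integrals against `ν N` converge to its
integral against `κ`. -/
def IntegralConverges (M : ℝ) (ν : ℕ → ProbabilityMeasure ℝ) (κ : ProbabilityMeasure ℝ)
    (φ : ℝ → ℝ) : Prop :=
  ContinuousOn φ (Set.Icc 0 M) ∧
    Tendsto (fun N => ∫ x, φ x ∂(ν N : Measure ℝ)) atTop (𝓝 (∫ x, φ x ∂(κ : Measure ℝ)))

theorem IntegralConverges.const (c : ℝ) : IntegralConverges M ν κ fun _ => c :=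
  ⟨continuousOn_const, by simp⟩

theorem IntegralConverges.const_mul {φ : ℝ → ℝ} (h : IntegralConverges M ν κ φ) (c : ℝ) :
    IntegralConverges M ν κ fun x => c * φ x :=
  ⟨continuousOn_const.mul h.1, by simpa only [integral_const_mul] using h.2.const_mul c⟩

include hν hκ

theorem IntegralConverges.add {φ ψ : ℝ → ℝ} (hφ : IntegralConverges M ν κ φ)
    (hψ : IntegralConverges M ν κ ψ) : IntegralConverges M ν κ fun x => φ x + ψ x := by
  refine ⟨hφ.1.add hψ.1, ?_⟩
  have h1 : ∀ N, ∫ x, (φ x + ψ x) ∂(ν N : Measure ℝ) =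
      ∫ x, φ x ∂(ν N : Measure ℝ) + ∫ x, ψ x ∂(ν N : Measure ℝ) := fun N =>
    integral_add (integrable_of_continuousOn_of_ae_mem (hν N) hφ.1)
      (integrable_of_continuousOn_of_ae_mem (hν N) hψ.1)
  rw [integral_add (integrable_of_continuousOn_of_ae_mem hκ hφ.1)
    (integrable_of_continuousOn_of_ae_mem hκ hψ.1)]
  simp only [h1]
  exact hφ.2.add hψ.2

theorem IntegralConverges.sum {ι : Type*} (s : Finset ι) {φ : ι → ℝ → ℝ}
    (hφ : ∀ i ∈ s, IntegralConverges M ν κ (φ i)) :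
    IntegralConverges M ν κ fun x => ∑ i ∈ s, φ i x := by
  classical
  induction s using Finset.induction_on with
  | empty => simpa using IntegralConverges.const 0
  | insert a s ha ih =>
    simp only [Finset.sum_insert ha]
    exact (hφ a (Finset.mem_insert_self a s)).add hν hκ
      (ih fun i hi => hφ i (Finset.mem_insert_of_mem hi))

/-- Convergence of integrals passes to uniform limits on `[0, M]`. -/
theorem IntegralConverges.of_approx {φ : ℝ → ℝ} (hφ : ContinuousOn φ (Set.Icc 0 M))
    (happ : ∀ ε > 0, ∃ ψ, IntegralConverges M ν κ ψ ∧ ∀ x ∈ Set.Icc 0 M, |ψ x - φ x| ≤ ε) :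
    IntegralConverges M ν κ φ := by
  refine ⟨hφ, Metric.tendsto_atTop.mpr fun ε hε => ?_⟩
  obtain ⟨ψ, hψ, hclose⟩ := happ (ε / 4) (by positivity)
  obtain ⟨N₀, hN₀⟩ := Metric.tendsto_atTop.mp hψ.2 (ε / 4) (by positivity)
  have hdiff : ∀ ρ : ProbabilityMeasure ℝ, (∀ᵐ x ∂(ρ : Measure ℝ), x ∈ Set.Icc 0 M) →
      |∫ x, ψ x ∂(ρ : Measure ℝ) - ∫ x, φ x ∂(ρ : Measure ℝ)| ≤ ε / 4 := by
    intro ρ hρ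
    rw [← integral_sub (integrable_of_continuousOn_of_ae_mem hρ hψ.1)
      (integrable_of_continuousOn_of_ae_mem hρ hφ)]
    simpa using norm_integral_le_of_norm_le_const (μ := (ρ : Measure ℝ))
      (f := fun x => ψ x - φ x) (hρ.mono fun x hx => hclose x hx)
  refine ⟨N₀, fun N hN => ?_⟩
  have h1 := hN₀ N hN
  have h2 := abs_le.mp (hdiff (ν N) (hν N))
  have h3 := abs_le.mp (hdiff κ hκ)
  rw [Real.dist_eq] at h1 ⊢
  rw [abs_lt] at h1 ⊢
  constructor <;> linarith [h1.1, h1.2, h2.1, h2.2, h3.1, h3.2]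

variable (hM : 0 < M)
  (hlog : ∀ s > 0, Tendsto (fun N => ∫ x, Real.log (s + x) ∂(ν N : Measure ℝ)) atTop
    (𝓝 (∫ x, Real.log (s + x) ∂(κ : Measure ℝ))))

include hM hlog

/-- The moments converge, by induction on the degree: for small `u > 0`, `log (1 + u x)`
determines `x ^ (m + 1)` up to `O(u)` and monomials of lower degree. -/
theorem integralConverges_pow (k : ℕ) : IntegralConverges M ν κ fun x => x ^ k := by
  induction k using Nat.strong_induction_on with
  | _ k ih =>
  rcases k with _ | m
  · simpa using IntegralConverges.const 1
  refine IntegralConverges.of_approx hν hκ (by fun_prop) fun ε hε => ?_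
  set u : ℝ := min (1 / (2 * M)) (ε / (2 * (m + 1) * M ^ (m + 2))) with hu
  have hupos : 0 < u := by positivity
  have huM : u * M ≤ 1 / 2 := by
    calc u * M ≤ 1 / (2 * M) * M := by gcongr; exact min_le_left _ _
      _ = 1 / 2 := by field_simp
  have huε : 2 * (m + 1) * M ^ (m + 2) * u ≤ ε := by
    calc 2 * (m + 1) * M ^ (m + 2) * u
        ≤ 2 * (m + 1) * M ^ (m + 2) * (ε / (2 * (m + 1) * M ^ (m + 2))) := by
          gcongr; exact min_le_right _ _
      _ = ε := by field_simp
  have hlogu : IntegralConverges M ν κ fun x => Real.log (u⁻¹ + x) := by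
    refine ⟨ContinuousOn.log (by fun_prop) fun x hx => ?_, hlog _ (inv_pos.mpr hupos)⟩
    have := hx.1
    positivity
  set c : ℝ := -((m + 1) / (-u) ^ (m + 1)) with hc
  -- `ψ` is the quotient `(log (1 + u x) - lower order terms) / (coefficient of x ^ (m + 1))`.
  have hψ := ((hlogu.add hν hκ (IntegralConverges.const (Real.log u))).add hν hκ
    (IntegralConverges.sum hν hκ (Finset.range m) (φ := fun i x => (-u) ^ (i + 1) / (i + 1) *
      x ^ (i + 1)) fun i hi => (ih (i + 1) (by simpa using hi)).const_mul _)).const_mul c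
  refine ⟨_, hψ, fun x hx => ?_⟩
  have hux : 0 ≤ u * x := mul_nonneg hupos.le hx.1
  have huxM : u * x ≤ u * M := by gcongr; exact hx.2
  have habs : |(-u) * x| = u * x := by rw [neg_mul, abs_neg, abs_of_nonneg hux]
  have htaylor := Real.abs_log_sub_add_sum_range_le (x := (-u) * x)
    (by rw [habs]; linarith) (m + 1)
  have hlogeq : Real.log (1 - (-u) * x) = Real.log (u⁻¹ + x) + Real.log u := by
    have h1 : 0 < u⁻¹ + x := add_pos_of_pos_of_nonneg (inv_pos.mpr hupos) hx.1
    rw [← Real.log_mul h1.ne' hupos.ne']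
    congr 1
    field_simp
    ring
  rw [Finset.sum_range_succ, hlogeq, habs] at htaylor
  have hune : (-u) ^ (m + 1) ≠ 0 := pow_ne_zero _ (neg_ne_zero.mpr hupos.ne')
  have hcabs : |c| = (m + 1) / u ^ (m + 1) := by
    rw [hc, abs_neg, abs_div, abs_pow, abs_neg, abs_of_pos hupos, abs_of_pos (by positivity)]
  have hid : c * (Real.log (u⁻¹ + x) + Real.log u +
      ∑ i ∈ Finset.range m, (-u) ^ (i + 1) / (i + 1) * x ^ (i + 1)) - x ^ (m + 1) =
      c * (∑ i ∈ Finset.range m, (-u * x) ^ (i + 1) / (i + 1) +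
        (-u * x) ^ (m + 1) / ((m : ℕ) + 1) + (Real.log (u⁻¹ + x) + Real.log u)) := by
    have h1 : c * ((-u * x) ^ (m + 1) / ((m : ℕ) + 1)) = -x ^ (m + 1) := by
      rw [hc, mul_pow]
      field_simp
    have h2 : ∀ i : ℕ, (-u * x) ^ (i + 1) / ((i : ℝ) + 1) =
        (-u) ^ (i + 1) / (i + 1) * x ^ (i + 1) := fun i => by
      rw [mul_pow]
      ring
    simp only [h2] at h1 ⊢
    linear_combination -h1
  rw [hid, abs_mul, hcabs]
  calc (m + 1) / u ^ (m + 1) * _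
      ≤ (m + 1) / u ^ (m + 1) * ((u * x) ^ (m + 1 + 1) / (1 - u * x)) := by gcongr
    _ ≤ (m + 1) / u ^ (m + 1) * ((u * M) ^ (m + 1 + 1) / (1 / 2)) := by
        gcongr
        linarith
    _ = 2 * (m + 1) * M ^ (m + 2) * u := by
        rw [mul_pow]
        field_simp
        ring
    _ ≤ ε := huε

/-- Probability measures on `[0, M]` converge weakly as soon as their integrals of `log (s + x)`
converge for all `s > 0`. -/
theorem tendsto_of_tendsto_integral_log : Tendsto ν atTop (𝓝 κ) := by
  rw [ProbabilityMeasure.tendsto_iff_forall_integral_tendsto]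
  intro φ
  refine (IntegralConverges.of_approx hν hκ φ.continuous.continuousOn fun ε hε => ?_).2
  obtain ⟨p, hp⟩ := exists_polynomial_near_of_continuousOn 0 M φ φ.continuous.continuousOn ε hε
  refine ⟨fun x => ∑ i ∈ Finset.range (p.natDegree + 1), p.coeff i * x ^ i,
    IntegralConverges.sum hν hκ _ fun i _ =>
      (integralConverges_pow hν hκ hM hlog i).const_mul _, fun x hx => ?_⟩
  simp only [← Polynomial.eval_eq_sum_range]
  exact (hp x hx).le

end WeakLimit

/-! ### The generalized eigenvalue problem for a pair of matrices -/

open scoped MatrixOrder in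
/-- If `A` is Hermitian and `B = Cᴴ C` is positive definite, then `A B⁻¹` has the same
characteristic polynomial as the Hermitian matrix `(C⁻¹)ᴴ A C⁻¹`. -/
theorem exists_isOrderedSpectrum {n : ℕ} {A B : Matrix (Fin n) (Fin n) ℂ} (hA : A.IsHermitian)
    (hB : B.PosDef) : ∃ μ : Fin n → ℝ, IsOrderedSpectrum (A * B⁻¹) μ := by
  obtain ⟨C, hC⟩ := CStarAlgebra.nonneg_iff_eq_star_mul_self.mp hB.posSemidef.nonneg
  have hH : ((C⁻¹)ᴴ * A * C⁻¹).IsHermitian := isHermitian_conjTranspose_mul_mul _ hA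
  have hchar : (A * B⁻¹).charpoly = ((C⁻¹)ᴴ * A * C⁻¹).charpoly := by
    rw [hC, star_eq_conjTranspose, Matrix.mul_inv_rev, ← Matrix.mul_assoc, charpoly_mul_comm,
      ← Matrix.mul_assoc, conjTranspose_nonsing_inv]
  refine ⟨hH.eigenvalues ∘ Tuple.sort hH.eigenvalues, Tuple.monotone_sort _, ?_⟩
  rw [hchar, hH.charpoly_eq]
  exact (Equiv.prod_comp (Tuple.sort hH.eigenvalues)
    fun i => Polynomial.X - Polynomial.C (hH.eigenvalues i : ℂ)).symm

theorem det_add_smul_eq_prod {n : ℕ} {A B : Matrix (Fin n) (Fin n) ℂ} (hB : IsUnit B.det)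
    {μ : Fin n → ℝ} (hμ : IsOrderedSpectrum (A * B⁻¹) μ) (s : ℂ) :
    (A + s • B).det = (∏ i, (s + μ i)) * B.det := by
  have h1 : A + s • B = (A * B⁻¹ + scalar (Fin n) s) * B := by
    rw [Matrix.add_mul, Matrix.mul_assoc, nonsing_inv_mul B hB, Matrix.mul_one,
      scalar_apply, ← smul_one_eq_diagonal, smul_mul_assoc, Matrix.one_mul]
  have h2 : (A * B⁻¹ + scalar (Fin n) s).det = ∏ i, (s + μ i) := by
    have h3 := congrArg (Polynomial.eval (-s)) hμ.2
    rw [eval_charpoly, Polynomial.eval_prod] at h3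
    have h4 : scalar (Fin n) (-s) - A * B⁻¹ = -(A * B⁻¹ + scalar (Fin n) s) := by
      rw [map_neg]
      abel
    rw [h4, det_neg] at h3
    have h5 : ∏ i, Polynomial.eval (-s) (Polynomial.X - Polynomial.C (μ i : ℂ)) =
        (-1) ^ n * ∏ i, (s + μ i) := by
      have : ∀ i, Polynomial.eval (-s) (Polynomial.X - Polynomial.C (μ i : ℂ)) =
          (-1) * (s + μ i) := fun i => by
        simp only [Polynomial.eval_sub, Polynomial.eval_X, Polynomial.eval_C]
        ring
      simp only [this, Finset.prod_mul_distrib, Finset.prod_const, Finset.card_univ,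
        Fintype.card_fin]
    rw [h5, Fintype.card_fin] at h3
    exact mul_left_cancel₀ (pow_ne_zero _ (neg_ne_zero.mpr one_ne_zero)) h3
  rw [h1, det_mul, h2]

/-! ### Distribution of the eigenvalues of preconditioned Toeplitz matrices -/

theorem integral_empiricalMeasure {N : ℕ} (μ : Fin (N + 1) → ℝ) (φ : ℝ → ℝ) :
    ∫ x, φ x ∂(empiricalMeasure μ : Measure ℝ) = ((N : ℝ) + 1)⁻¹ * ∑ i, φ (μ i) := by
  change ∫ x, φ x ∂(((N : ENNReal) + 1)⁻¹ • ∑ i, Measure.dirac (μ i)) = _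
  rw [integral_smul_measure, integral_finsetSum_measure fun i _ => integrable_dirac (by simp)]
  simp only [integral_dirac, smul_eq_mul]
  congr 1
  rw [ENNReal.toReal_inv, ENNReal.toReal_add (by simp) (by simp)]
  simp

theorem ae_empiricalMeasure {N : ℕ} {μ : Fin (N + 1) → ℝ} {p : ℝ → Prop} (h : ∀ i, p (μ i)) :
    ∀ᵐ x ∂(empiricalMeasure μ : Measure ℝ), p x := by
  change ∀ᵐ x ∂(((N : ENNReal) + 1)⁻¹ • ∑ i, Measure.dirac (μ i)), p x
  refine Measure.ae_smul_measure ?_ _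
  rw [ae_iff, Measure.finsetSum_apply]
  refine Finset.sum_eq_zero fun i _ => ?_
  rw [← ae_iff, ae_dirac_eq]
  exact h i

theorem isUnit_det_toeplitz {g : Torus → ℝ} (hg : Integrable g haarAddCircle) {δ : ℝ}
    (hδ : 0 < δ) (hgδ : ∀ᵐ θ ∂haarAddCircle, δ ≤ g θ) (N : ℕ) : IsUnit (toeplitz N g).det :=
  (isUnit_iff_isUnit_det _).mp
    (posDef_toeplitz N hg (hgδ.mono fun _ h => hδ.trans_le h)).isUnit

section Pair

variable {f g : Torus → ℝ} (hf : Integrable f haarAddCircle) (hg : Integrable g haarAddCircle)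
  {δ M : ℝ} (hδ : 0 < δ) (hgδ : ∀ᵐ θ ∂haarAddCircle, δ ≤ g θ)
  (hf₀ : ∀ᵐ θ ∂haarAddCircle, 0 ≤ f θ) (hfM : ∀ᵐ θ ∂haarAddCircle, f θ ≤ M * g θ)

include hf hg

theorem toeplitz_add_smul (N : ℕ) (s : ℝ) :
    toeplitz N f + (s : ℂ) • toeplitz N g = toeplitz N fun θ => f θ + s * g θ := by
  rw [toeplitz_add N hf (hg.const_mul s), toeplitz_const_mul]

include hδ hgδ hf₀ hfM

/-- The eigenvalues lie in every interval that contains the values of `f / g`: for `x` outside it,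
`± (T_N(f) - x T_N(g))` is the Toeplitz matrix of an almost everywhere positive symbol. -/
theorem mem_Icc_of_isOrderedSpectrum {N : ℕ} {μ : Fin (N + 1) → ℝ}
    (hμ : IsOrderedSpectrum (toeplitz N f * (toeplitz N g)⁻¹) μ) (i : Fin (N + 1)) :
    μ i ∈ Set.Icc 0 M := by
  have hdet : (toeplitz N fun θ => f θ + -μ i * g θ).det = 0 := by
    rw [← toeplitz_add_smul hf hg, det_add_smul_eq_prod (isUnit_det_toeplitz hg hδ hgδ N) hμ,
      Finset.prod_eq_zero (Finset.mem_univ i) (by simp), zero_mul]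
  have hint : Integrable (fun θ => f θ + -μ i * g θ) haarAddCircle := hf.add (hg.const_mul _)
  constructor
  · by_contra! hneg
    refine ((isUnit_iff_isUnit_det _).mp (posDef_toeplitz N hint ?_).isUnit).ne_zero hdet
    filter_upwards [hgδ, hf₀] with θ h1 h2
    have : 0 < -μ i * g θ := mul_pos (neg_pos.mpr hneg) (hδ.trans_le h1)
    linarith
  · by_contra! hlt
    have hpos : (toeplitz N fun θ => -1 * (f θ + -μ i * g θ)).PosDef := by
      refine posDef_toeplitz N (hint.const_mul _) ?_
      filter_upwards [hgδ, hfM] with θ h1 h2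
      have : 0 < (μ i - M) * g θ := mul_pos (sub_pos.mpr hlt) (hδ.trans_le h1)
      linarith
    refine ((isUnit_iff_isUnit_det _).mp hpos.isUnit).ne_zero ?_
    rw [toeplitz_const_mul, det_smul, hdet, mul_zero]

theorem integral_log_empiricalMeasure {N : ℕ} {μ : Fin (N + 1) → ℝ}
    (hμ : IsOrderedSpectrum (toeplitz N f * (toeplitz N g)⁻¹) μ) {s : ℝ} (hs : 0 < s) :
    ∫ x, Real.log (s + x) ∂(empiricalMeasure μ : Measure ℝ) =
      ((N : ℝ) + 1)⁻¹ * Real.log ‖(toeplitz N fun θ => f θ + s * g θ).det‖ -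
        ((N : ℝ) + 1)⁻¹ * Real.log ‖(toeplitz N g).det‖ := by
  have hu := isUnit_det_toeplitz hg hδ hgδ N
  have hpos : ∀ i, 0 < s + μ i := fun i =>
    add_pos_of_pos_of_nonneg hs (mem_Icc_of_isOrderedSpectrum hf hg hδ hgδ hf₀ hfM hμ i).1
  have hnorm : ‖∏ i, ((s : ℂ) + μ i)‖ = ∏ i, (s + μ i) := by
    rw [norm_prod]
    refine Finset.prod_congr rfl fun i _ => ?_
    rw [← Complex.ofReal_add, Complex.norm_real, Real.norm_of_nonneg (hpos i).le]
  rw [integral_empiricalMeasure, ← toeplitz_add_smul hf hg, det_add_smul_eq_prod hu hμ, norm_mul,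
    hnorm, Real.log_mul (Finset.prod_pos fun i _ => hpos i).ne' (norm_ne_zero_iff.mpr hu.ne_zero),
    Real.log_prod fun i _ => (hpos i).ne']
  ring

/-- The eigenvalues of `T_N(f) T_N(g)⁻¹` are distributed like the values of `f / g`. -/
theorem tendsto_empiricalMeasure (hmeas : Measurable fun θ => f θ / g θ)
    {μ : (N : ℕ) → Fin (N + 1) → ℝ}
    (hμ : ∀ N, IsOrderedSpectrum (toeplitz N f * (toeplitz N g)⁻¹) (μ N)) :
    Tendsto (fun N => empiricalMeasure (μ N)) atTop
      (𝓝 (lebesgueTorus.map hmeas.aemeasurable)) := by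
  have hmap : ((lebesgueTorus.map hmeas.aemeasurable : ProbabilityMeasure ℝ) : Measure ℝ) =
      Measure.map (fun θ => f θ / g θ) haarAddCircle := rfl
  -- The weak convergence criterion needs an interval `[0, M]` of positive length.
  have hfM' : ∀ᵐ θ ∂haarAddCircle, f θ ≤ max M 1 * g θ := by
    filter_upwards [hgδ, hfM] with θ h1 h2
    exact h2.trans (mul_le_mul_of_nonneg_right (le_max_left _ _) (hδ.le.trans h1))
  refine tendsto_of_tendsto_integral_log (M := max M 1) (fun N => ae_empiricalMeasure fun i =>
    mem_Icc_of_isOrderedSpectrum hf hg hδ hgδ hf₀ hfM' (hμ N) i) ?_ (by positivity) fun s hs => ?_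
  · rw [hmap]
    refine (ae_map_iff hmeas.aemeasurable (p := fun x => x ∈ Set.Icc 0 (max M 1))
      measurableSet_Icc).mpr ?_
    filter_upwards [hgδ, hf₀, hfM'] with θ h1 h2 h3
    have hpos := hδ.trans_le h1
    exact ⟨div_nonneg h2 hpos.le, (div_le_iff₀ hpos).mpr h3⟩
  · have hsum : Integrable (fun θ => f θ + s * g θ) haarAddCircle := hf.add (hg.const_mul s)
    have hsumδ : ∀ᵐ θ ∂haarAddCircle, s * δ ≤ f θ + s * g θ := by
      filter_upwards [hgδ, hf₀] with θ h1 h2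
      have := mul_le_mul_of_nonneg_left h1 hs.le
      linarith
    have hlim := (tendsto_log_norm_det_toeplitz hsum (mul_pos hs hδ) hsumδ).sub
      (tendsto_log_norm_det_toeplitz hg hδ hgδ)
    have hval : ∫ x, Real.log (s + x) ∂(lebesgueTorus.map hmeas.aemeasurable : Measure ℝ) =
        ∫ θ, Real.log (f θ + s * g θ) ∂haarAddCircle -
          ∫ θ, Real.log (g θ) ∂haarAddCircle := by
      have hlogm : Measurable fun x : ℝ => Real.log (s + x) :=
        Real.measurable_log.comp (measurable_const_add s)
      rw [hmap, integral_map hmeas.aemeasurable hlogm.aestronglyMeasurable,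
        ← integral_sub (integrable_log hsum (mul_pos hs hδ) hsumδ) (integrable_log hg hδ hgδ)]
      refine integral_congr_ae ?_
      filter_upwards [hgδ, hf₀] with θ h1 h2
      have hpos := hδ.trans_le h1
      have hnum : 0 < f θ + s * g θ := by positivity
      rw [← Real.log_div hnum.ne' hpos.ne']
      congr 1
      field_simp
      ring
    rw [hval]
    simpa only [integral_log_empiricalMeasure hf hg hδ hgδ hf₀ hfM' (hμ _) hs] using hlim

end Pair

/-! ### Fisher–Hartwig symbols -/

theorem continuous_chi : Continuous chi :=
  continuous_subtype_val.comp AddCircle.continuous_toCircle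

theorem norm_one_sub_chi_le (θ : Torus) : ‖1 - chi θ‖ ≤ 2 := by
  have h : ‖chi θ‖ = 1 := Circle.norm_coe _
  have := norm_sub_le (1 : ℂ) (chi θ)
  rw [norm_one, h] at this
  linarith

theorem norm_one_sub_chi_coe (x : ℝ) : ‖1 - chi (x : Torus)‖ = 2 * |Real.sin (x / 2)| := by
  have h : chi (x : Torus) = Complex.exp (Complex.I * x) := by
    have h1 := fourier_coe_apply (T := 2 * Real.pi) (n := 1) (x := x)
    rw [fourier_one] at h1
    rw [chi, h1]
    congr 1
    have := Real.pi_ne_zero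
    push_cast
    field_simp
  rw [h, norm_sub_rev, Complex.norm_exp_I_mul_ofReal_sub_one, norm_mul, Real.norm_eq_abs,
    Real.norm_eq_abs, abs_two]

theorem ae_norm_one_sub_chi_pos : ∀ᵐ θ ∂(haarAddCircle : Measure Torus), 0 < ‖1 - chi θ‖ := by
  have h0 : (haarAddCircle : Measure Torus) {0} = 0 := by
    have h1 : (volume : Measure Torus) {0} = 0 := by
      have := volume_closedBall (T := 2 * Real.pi) (x := 0) 0
      rw [Metric.closedBall_zero] at this
      rw [this]
      simp [Real.pi_pos.le]
    rw [volume_eq_smul_haarAddCircle, Measure.smul_apply, smul_eq_mul, mul_eq_zero] at h1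
    exact h1.resolve_left (by simp [Real.pi_pos])
  filter_upwards [measure_eq_zero_iff_ae_notMem.mp h0] with θ hθ
  rw [norm_pos_iff, sub_ne_zero]
  intro h
  apply hθ
  refine AddCircle.injective_toCircle Real.two_pi_pos.ne' ?_
  rw [AddCircle.toCircle_zero]
  ext
  exact h.symm

theorem integrable_abs_rpow {r : ℝ} (hr : -1 < r) (a b : ℝ) :
    IntervalIntegrable (fun x : ℝ => |x| ^ r) volume a b := by
  refine intervalIntegrable_of_even (fun x => by rw [abs_neg]) fun x hx => ?_
  refine (intervalIntegral.intervalIntegrable_rpow' hr (a := 0) (b := x)).congr fun y hy => ?_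
  rw [Set.uIoc_of_le hx.le] at hy
  simp only [abs_of_pos hy.1]

/-- The singularity `|1 - χ|^{2α}` is integrable for `-1/2 < α ≤ 0`, by comparison with
`|θ|^{2α}` on `(-π, π]`. -/
theorem integrable_norm_one_sub_chi_rpow {α : ℝ} (hα : -(1 / 2) < α) (hα' : α ≤ 0) :
    Integrable (fun θ => ‖1 - chi θ‖ ^ (2 * α)) (haarAddCircle : Measure Torus) := by
  have hmeas : Measurable fun θ => ‖1 - chi θ‖ ^ (2 * α) :=
    (continuous_const.sub continuous_chi).norm.measurable.pow_const _
  have hpi := Real.pi_pos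
  have hvol : Integrable (fun θ => ‖1 - chi θ‖ ^ (2 * α)) (volume : Measure Torus) := by
    rw [← (AddCircle.measurePreserving_mk (2 * Real.pi) (-Real.pi)).integrable_comp
      hmeas.aestronglyMeasurable]
    have hdom := ((integrable_abs_rpow (by linarith : -1 < 2 * α) (-Real.pi)
      (-Real.pi + 2 * Real.pi)).const_mul ((2 / Real.pi) ^ (2 * α)))
    rw [intervalIntegrable_iff_integrableOn_Ioc_of_le (by linarith)] at hdom
    refine hdom.mono' (hmeas.comp AddCircle.measurable_mk').aestronglyMeasurable ?_
    have hne : ∀ᵐ x : ℝ ∂(volume.restrict (Set.Ioc (-Real.pi) (-Real.pi + 2 * Real.pi))),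
        x ≠ 0 := ae_restrict_of_ae (Measure.ae_ne volume 0)
    filter_upwards [hne, ae_restrict_mem measurableSet_Ioc] with x hx hmem
    have habs : |x / 2| ≤ Real.pi / 2 := by
      rw [abs_le]
      constructor <;> linarith [hmem.1, hmem.2]
    have hsin := Real.mul_abs_le_abs_sin habs
    have hle : 2 / Real.pi * |x| ≤ 2 * |Real.sin (x / 2)| := by
      rw [abs_div, abs_two] at hsin
      calc 2 / Real.pi * |x| = 2 * (2 / Real.pi * (|x| / 2)) := by ring
        _ ≤ _ := by gcongr
    have hxpos : 0 < |x| := abs_pos.mpr hx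
    rw [Function.comp_apply, Real.norm_of_nonneg (by positivity), norm_one_sub_chi_coe,
      ← Real.mul_rpow (by positivity) (abs_nonneg x)]
    exact Real.rpow_le_rpow_of_nonpos (by positivity) hle (by linarith)
  rw [volume_eq_smul_haarAddCircle] at hvol
  exact (integrable_smul_measure (by simp [hpi]) ENNReal.ofReal_ne_top).mp hvol

theorem integrable_symbol {α : ℝ} (hα : -(1 / 2) < α) (c : C(Torus, ℝ)) :
    Integrable (symbol α c) haarAddCircle := by
  obtain ⟨C, hC⟩ := isCompact_univ.exists_bound_of_continuousOn c.continuous.continuousOn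
  have hr : Integrable (fun θ => ‖1 - chi θ‖ ^ (2 * α)) (haarAddCircle : Measure Torus) := by
    rcases le_total α 0 with h | h
    · exact integrable_norm_one_sub_chi_rpow hα h
    · exact ((continuous_const.sub continuous_chi).norm.rpow_const fun _ =>
        Or.inr (by positivity)).integrable_of_hasCompactSupport
          (HasCompactSupport.of_compactSpace _)
  exact hr.mul_bdd c.continuous.aestronglyMeasurable (ae_of_all _ fun θ => hC θ trivial)

theorem exists_pos_forall_le (c : C(Torus, ℝ)) (hc : ∀ θ, 0 < c θ) : ∃ m > 0, ∀ θ, m ≤ c θ := by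
  obtain ⟨θ₀, -, h⟩ := isCompact_univ.exists_isMinOn Set.univ_nonempty c.continuous.continuousOn
  exact ⟨c θ₀, hc θ₀, fun θ => h (Set.mem_univ θ)⟩

/-- For a nonpositive exponent the symbol is bounded below by a positive constant away from the
point `0`, where a power of zero with negative exponent is the junk value `0`. -/
theorem exists_pos_ae_le_symbol {α : ℝ} (hα : α ≤ 0) (c : C(Torus, ℝ)) (hc : ∀ θ, 0 < c θ) :
    ∃ δ > 0, ∀ᵐ θ ∂haarAddCircle, δ ≤ symbol α c θ := by
  obtain ⟨m, hm, hle⟩ := exists_pos_forall_le c hc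
  refine ⟨2 ^ (2 * α) * m, by positivity, ?_⟩
  filter_upwards [ae_norm_one_sub_chi_pos] with θ hθ
  exact mul_le_mul (Real.rpow_le_rpow_of_nonpos hθ (norm_one_sub_chi_le θ) (by linarith))
    (hle θ) hm.le (by positivity)

theorem exists_symbol_le {α : ℝ} (hα : 0 ≤ α) (c : C(Torus, ℝ)) (hc : ∀ θ, 0 < c θ) :
    ∃ K, 0 ≤ K ∧ ∀ θ, symbol α c θ ≤ K := by
  obtain ⟨C, hC⟩ := isCompact_univ.exists_bound_of_continuousOn c.continuous.continuousOn
  have hC0 : 0 ≤ C := (norm_nonneg _).trans (hC 0 trivial)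
  refine ⟨2 ^ (2 * α) * C, by positivity, fun θ => ?_⟩
  exact mul_le_mul (Real.rpow_le_rpow (norm_nonneg _) (norm_one_sub_chi_le θ) (by positivity))
    ((le_abs_self _).trans (hC θ trivial)) (hc θ).le (by positivity)

end ToeplitzSpectra

theorem mainTheorem6 (α₁ α₂ : ℝ) (hα₁ : 0 < α₁) (hα₁' : α₁ < 1 / 2)
    (hα₂ : -(1 / 2) < α₂) (hα₂' : α₂ < 0)
    (c₁ c₂ : C(Torus, ℝ)) (hc₁ : ∀ θ, 0 < c₁ θ) (hc₂ : ∀ θ, 0 < c₂ θ)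
    (hA₁ : MemA (3 / 2) fun θ => (c₁ θ : ℂ)) (hA₂ : MemA (3 / 2) fun θ => (c₂ θ : ℂ))
    (heven₁ : ∀ θ, symbol α₁ c₁ (-θ) = symbol α₁ c₁ θ)
    (heven₂ : ∀ θ, symbol α₂ c₂ (-θ) = symbol α₂ c₂ θ) :
    (∀ N : ℕ, IsUnit (toeplitz N (symbol α₂ c₂)).det ∧
      ∃ μ : Fin (N + 1) → ℝ,
        IsOrderedSpectrum (toeplitz N (symbol α₁ c₁) * (toeplitz N (symbol α₂ c₂))⁻¹) μ) ∧
    ∀ μ : (N : ℕ) → Fin (N + 1) → ℝ,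
      (∀ N : ℕ, IsOrderedSpectrum
        (toeplitz N (symbol α₁ c₁) * (toeplitz N (symbol α₂ c₂))⁻¹) (μ N)) →
      Filter.Tendsto (fun N : ℕ => empiricalMeasure (μ N)) Filter.atTop
        (𝓝 (lebesgueTorus.map (measurable_symbol_div α₁ α₂ c₁ c₂).aemeasurable)) := by
  have hf := integrable_symbol (by linarith : -(1 / 2) < α₁) c₁
  have hg := integrable_symbol hα₂ c₂
  obtain ⟨δ, hδ, hgδ⟩ := exists_pos_ae_le_symbol hα₂'.le c₂ hc₂
  obtain ⟨K, hK, hfK⟩ := exists_symbol_le hα₁.le c₁ hc₁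
  have hf₀ : ∀ᵐ θ ∂AddCircle.haarAddCircle, 0 ≤ symbol α₁ c₁ θ :=
    MeasureTheory.ae_of_all _ fun θ => mul_nonneg (by positivity) (hc₁ θ).le
  -- The numerator is at most `K` and the denominator at least `δ`, so `f₁ / f₂ ≤ K / δ`.
  have hfM : ∀ᵐ θ ∂AddCircle.haarAddCircle,
      symbol α₁ c₁ θ ≤ K / δ * symbol α₂ c₂ θ := by
    filter_upwards [hgδ] with θ hθ
    calc symbol α₁ c₁ θ ≤ K / δ * δ := by rw [div_mul_cancel₀ _ hδ.ne']; exact hfK θ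
      _ ≤ _ := mul_le_mul_of_nonneg_left hθ (by positivity)
  refine ⟨fun N => ⟨isUnit_det_toeplitz hg hδ hgδ N, ?_⟩, fun μ hμ => ?_⟩
  · exact exists_isOrderedSpectrum (isHermitian_toeplitz N _)
      (posDef_toeplitz N hg (hgδ.mono fun _ h => hδ.trans_le h))
  · exact tendsto_empiricalMeasure hf hg hδ hgδ hf₀ hfM
      (measurable_symbol_div α₁ α₂ c₁ c₂) hμ
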